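/- Let $N\ge 3$. Let $B_1=\chi_{[0,1)}$ and $B_n(x)=\int_0^1B_{n-1}(x-t)\,dt$ for $n\ge2$ be the B-splines, and let $$\mathcal B_N=\Big\{\sum_{k\in\mathbb Z}c_kB_N(\cdot-k):\ c_k\in\mathbb C\Big\}$$ be the complex spline space of order $N$. Let $\Gamma,\Gamma'\subset(0,1)$ be sets of $2N-1$ and $2N-5$ distinct points, respectively. For $f=\sum_{k}c_kB_N(\cdot-k)\in\mathcal B_N$ put $K_-=\inf\{k\in\mathbb Z:c_k\ne0\}$ and $K_+=\sup\{k\in\mathbb Z:c_k\neq0\}$, and for unimodular $\xi_1,\xi_2\in\mathbb C$ put $$\kappa_-=\sup\{k\in\mathbb Z:\ \Im(\overline{\xi_1}c_l)=0\text{ for all }l\le k\},\qquad \kappa_+=\inf\{k\in\mathbb Z:\ k>\kappa_-,\ \Im(\overline{\xi_2}c_l)=0\text{ for all }l\ge k\},$$ all in $[-\infty,+\infty]$, with $\inf\emptyset=+\infty$ and $\sup\emptyset=-\infty$. Suppose that $f\in\mathcal B_N$ satisfies (i) $\sum_{l=0}^{N-2}|c_{k+l}|\ne0$ for all integers $k\in(K_--N+1,\,K_++1)$,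 and (ii) for some unimodular $\xi_1,\xi_2$: if $(\kappa_-,\kappa_+)\cap\mathbb Z\neq\emptyset$, then $\sum_{k-N+2\le n_1<n_2\le k}|\Im(c_{n_1}\overline{c_{n_2}})|\ne0$ for all integers $k$ with $\kappa_-+1\le k\le\kappa_++N-3$. Then $f$ is determined in $\mathcal B_N$, up to a unimodular constant and conjugation, by the phaseless Hermite samples $|f(\gamma)|$, $\gamma\in\Gamma+\mathbb Z$, and $|f'(\gamma')|$, $\gamma'\in\Gamma'+\mathbb Z$: if $g\in\mathcal B_N$ satisfies $|g(\gamma)|=|f(\gamma)|$ for all $\gamma\in\Gamma+\mathbb Z$ and $|g'(\gamma')|=|f'(\gamma')|$ for all $\gamma'\in\Gamma'+\mathbb Z$, then there is $z\in\mathbb C$ with $|z|=1$ such that $g=zf$ or $g=z\overline f$ on $\mathbb R$. -/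

import Mathlib

open scoped ComplexConjugate

noncomputable section

namespace ConjPhase

/-- The B-spline of order `N`: the characteristic function of `[0,1)` for `N = 1`, and
`B_N(x) = ∫₀¹ B_{N-1}(x - t) dt` for `N ≥ 2` (the value at `N = 0` is irrelevant). -/
def bSpline : ℕ → ℝ → ℝ
  | 0 => fun _ => 0
  | 1 => Set.indicator (Set.Ico (0 : ℝ) 1) (fun _ => 1)
  | (n + 2) => fun x => ∫ t in (0 : ℝ)..1, bSpline (n + 1) (x - t)

/-- `B_N` vanishes outside `[0, N]`. -/
theorem bSpline_eq_zero : ∀ (N : ℕ) (x : ℝ), (x < 0 ∨ (N : ℝ) < x) → bSpline N x = 0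
  | 0, _, _ => rfl
  | 1, x, h => by
      refine Set.indicator_of_notMem ?_ _
      rintro ⟨h0, h1⟩
      norm_num at h
      rcases h with h | h <;> linarith
  | (n + 2), x, h => by
      have key : ∀ t ∈ Set.uIcc (0 : ℝ) 1, bSpline (n + 1) (x - t) = 0 := by
        intro t ht
        rw [Set.uIcc_of_le zero_le_one] at ht
        apply bSpline_eq_zero (n + 1)
        push_cast at h ⊢
        rcases h with h | h
        · left; linarith [ht.1]
        · right; linarith [ht.2]
      calc bSpline (n + 2) x = ∫ t in (0 : ℝ)..1, bSpline (n + 1) (x - t) := rfl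
        _ = ∫ _ in (0 : ℝ)..1, (0 : ℝ) := intervalIntegral.integral_congr key
        _ = 0 := by simp

/-- The function `x ↦ ∑_{k ∈ ℤ} c_k B_N(x - k)`. -/
def splineSum (N : ℕ) (c : ℤ → ℂ) : ℝ → ℂ :=
  fun x => ∑' k : ℤ, c k * (bSpline N (x - k) : ℂ)

/-- At every point only finitely many terms of the series `splineSum N c` are nonzero. -/
theorem splineSum_finite_support (N : ℕ) (c : ℤ → ℂ) (x : ℝ) :
    (Function.support fun k : ℤ => c k * (bSpline N (x - k) : ℂ)).Finite := by
  refine (Set.finite_Icc ⌊x - N⌋ ⌈x⌉).subset fun k hk => ?_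
  have hb : bSpline N (x - k) ≠ 0 := by
    intro h0
    exact hk (by simp [h0])
  have h : ¬ (x - k < 0 ∨ (N : ℝ) < x - k) := fun h => hb (bSpline_eq_zero N _ h)
  rw [not_or, not_lt, not_lt] at h
  constructor
  · have h1 := Int.floor_le (x - N)
    have : ((⌊x - N⌋ : ℤ) : ℝ) ≤ (k : ℝ) := by linarith [h.2]
    exact_mod_cast this
  · have h1 := Int.le_ceil x
    have : (k : ℝ) ≤ ((⌈x⌉ : ℤ) : ℝ) := by linarith [h.1]
    exact_mod_cast this

/-- The complex spline space `𝓑_N = {∑_{k ∈ ℤ} c_k B_N(· - k) : c_k ∈ ℂ}`. -/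
def splineSpace (N : ℕ) : Set (ℝ → ℂ) := Set.range (splineSum N)

/-- An integer as an extended real number. -/
def toE (k : ℤ) : EReal := ((k : ℝ) : EReal)

/-- `K₋ = inf {k : c_k ≠ 0}` (so `K₋ = +∞` for `c = 0`). -/
def KMinus (c : ℤ → ℂ) : EReal := sInf (toE '' {k | c k ≠ 0})

/-- `K₊ = sup {k : c_k ≠ 0}` (so `K₊ = -∞` for `c = 0`). -/
def KPlus (c : ℤ → ℂ) : EReal := sSup (toE '' {k | c k ≠ 0})

/-- `κ₋ = sup {k : Im (ξ̄₁ c_l) = 0 for all l ≤ k}`. -/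
def kappaMinus (c : ℤ → ℂ) (ξ₁ : ℂ) : EReal :=
  sSup (toE '' {k | ∀ l ≤ k, (conj ξ₁ * c l).im = 0})

/-- `κ₊ = inf {k > κ₋ : Im (ξ̄₂ c_l) = 0 for all l ≥ k}`. -/
def kappaPlus (c : ℤ → ℂ) (ξ₁ ξ₂ : ℂ) : EReal :=
  sInf (toE '' {k | kappaMinus c ξ₁ < toE k ∧ ∀ l ≥ k, (conj ξ₂ * c l).im = 0})

/-- The index set `(κ₋, κ₊) ∩ ℤ` of the middle part of the decomposition. -/
def middleSet (c : ℤ → ℂ) (ξ₁ ξ₂ : ℂ) : Set ℤ :=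
  {k | kappaMinus c ξ₁ < toE k ∧ toE k < kappaPlus c ξ₁ ξ₂}

/-- Condition (i): `∑_{l=0}^{L-2} |c_{k+l}| ≠ 0` for all integers `k ∈ (K₋ - L + 1, K₊ + 1)`. -/
def CondI (L : ℕ) (c : ℤ → ℂ) : Prop :=
  ∀ k : ℤ, KMinus c - (((L : ℝ) - 1 : ℝ) : EReal) < toE k → toE k < KPlus c + 1 →
    ∑ l ∈ Finset.range (L - 1), ‖c (k + l)‖ ≠ 0

/-- Condition (ii): if the middle set is nonempty, then
`∑_{k-L+2 ≤ n₁ < n₂ ≤ k} |Im (c_{n₁} c̄_{n₂})| ≠ 0` for all integers `k` with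
`κ₋ + 1 ≤ k ≤ κ₊ + L - 3`. -/
def CondII (L : ℕ) (c : ℤ → ℂ) (ξ₁ ξ₂ : ℂ) : Prop :=
  (middleSet c ξ₁ ξ₂).Nonempty →
    ∀ k : ℤ, kappaMinus c ξ₁ + 1 ≤ toE k →
      toE k ≤ kappaPlus c ξ₁ ξ₂ + (((L : ℝ) - 3 : ℝ) : EReal) →
      ∑ p ∈ (Finset.Icc (k - L + 2) k ×ˢ Finset.Icc (k - L + 2) k).filter
        (fun p : ℤ × ℤ => p.1 < p.2), |(c p.1 * conj (c p.2)).im| ≠ 0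

end ConjPhase

end

/-!
On each interval `[j, j + 1]` a spline of order `N` is a polynomial `P_j` of degree at most `N - 1`,
a combination of the linearly independent polynomial pieces of `B_N` with coefficients
`c_{j-N+1}, …, c_j` (`splineSum_add_int`, `pieceComb_injective`).

*Local step.* The `2N - 1` values of `|P|` determine the polynomial `P P̄`, whose degree is at most
`2N - 2`. This fixes the two leading coefficients of `P' P̄'` (`natDegree_derivative_mul_sub_le`),
and the remaining `2N - 5` are found from the samples of `|P'|`. If `Q` has the same `P P̄` and
`P' P̄'`, then `{Q' Q̄, Q Q̄'}` and `{P' P̄, P P̄'}` have equal sum and product, so `Q' Q̄` is one of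
`P' P̄` and `P P̄'`. A vanishing Wronskian then gives `Q = z P` or `Q = z P̄`
(`exists_unimodular_or_conj`).

*Global step.* Hence the coefficients `d` of `g` satisfy `d = z_j c` or `d = z_j c̄` on each window
of `N` consecutive indices. The two alternatives exclude each other exactly when the coefficients
`c` in the window do not lie on one real line through `0`. By condition (ii), two non-collinear
windows are joined by a chain of windows with non-collinear overlaps (`not_collin_of_condII`), so
after a conjugation of `g` if necessary all windows satisfy `d = z_j c`. By condition (i), adjacent
windows have a nonzero coefficient in common, or else `c` vanishes on a whole half-line
(`eq_zero_of_condI`), so the `z_j` may be taken equal (`exists_global_phase`).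
-/

namespace ConjPhase

open Polynomial

/-! ### The polynomial pieces of a B-spline -/

/-- The antiderivative of a real polynomial that vanishes at `0`. -/
noncomputable def antideriv (p : ℝ[X]) : ℝ[X] :=
  p.sum fun n a => monomial (n + 1) (a / (n + 1))

theorem derivative_antideriv (p : ℝ[X]) : derivative (antideriv p) = p := by
  conv_rhs => rw [p.as_sum_support]
  rw [antideriv, Polynomial.sum, derivative_sum]
  refine Finset.sum_congr rfl fun n _ => ?_
  have : (n : ℝ) + 1 ≠ 0 := by positivity
  rw [derivative_monomial]
  rw [Nat.add_sub_cancel, Nat.cast_add_one, div_mul_cancel₀ _ this]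

theorem eval_zero_antideriv (p : ℝ[X]) : (antideriv p).eval 0 = 0 := by
  simp [antideriv, Polynomial.sum, eval_finsetSum]

theorem antideriv_zero : antideriv 0 = 0 := by simp [antideriv]

theorem natDegree_antideriv_le (p : ℝ[X]) : (antideriv p).natDegree ≤ p.natDegree + 1 := by
  refine natDegree_sum_le_of_forall_le _ _ fun n hn => ?_
  exact (natDegree_monomial_le _).trans (by have := le_natDegree_of_mem_supp n hn; omega)

theorem integral_eval_eq_antideriv (p : ℝ[X]) (a b : ℝ) :
    ∫ t in a..b, p.eval t = (antideriv p).eval b - (antideriv p).eval a := by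
  refine intervalIntegral.integral_eq_sub_of_hasDerivAt
    (f := fun t => (antideriv p).eval t) (fun t _ => ?_) (p.continuous.intervalIntegrable _ _)
  simpa only [derivative_antideriv] using (antideriv p).hasDerivAt t

/-- The polynomial that agrees with `x ↦ B_N(x + l)` on `[0, 1)`. The recursion splits the
integral defining `B_N` at the knot of `B_{N-1}`. -/
noncomputable def piece : ℕ → ℤ → ℝ[X]
  | 0, _ => 0
  | 1, l => if l = 0 then 1 else 0
  | n + 2, l => antideriv (piece (n + 1) l) +
      (C ((antideriv (piece (n + 1) (l - 1))).eval 1) - antideriv (piece (n + 1) (l - 1)))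

theorem bSpline_add_int : ∀ (N : ℕ) (l : ℤ) (x : ℝ), x ∈ Set.Ico (0 : ℝ) 1 →
    bSpline N (x + l) = (piece N l).eval x
  | 0, _, _, _ => by simp [bSpline, piece]
  | 1, l, x, hx => by
      simp only [bSpline, piece]
      by_cases hl : l = 0
      · subst hl
        rw [if_pos rfl, Set.indicator_of_mem (by simpa using hx), eval_one]
      · rw [if_neg hl, eval_zero, Set.indicator_of_notMem]
        rintro ⟨h0, h1⟩
        have h2 : ((-1 : ℤ) : ℝ) < l := by push_cast; linarith [hx.2]
        have h3 : (l : ℝ) < ((1 : ℤ) : ℝ) := by push_cast; linarith [hx.1]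
        have h2' := Int.cast_lt.1 h2
        have h3' := Int.cast_lt.1 h3
        omega
  | n + 2, l, x, hx => by
      have e1 : Set.EqOn (fun t => bSpline (n + 1) (x + l - t))
          (fun t => (piece (n + 1) l).eval (x - t)) (Set.uIoc 0 x) := by
        intro t ht
        rw [Set.uIoc_of_le hx.1] at ht
        have := bSpline_add_int (n + 1) l (x - t)
          ⟨by linarith [ht.2], by linarith [ht.1, hx.2]⟩
        simp only [← this]
        congr 1; ring
      have e2 : Set.EqOn (fun t => bSpline (n + 1) (x + l - t))
          (fun t => (piece (n + 1) (l - 1)).eval (x + 1 - t)) (Set.uIoc x 1) := by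
        intro t ht
        rw [Set.uIoc_of_le hx.2.le] at ht
        have := bSpline_add_int (n + 1) (l - 1) (x + 1 - t)
          ⟨by linarith [ht.2, hx.1], by linarith [ht.1]⟩
        simp only [← this]
        congr 1; push_cast; ring
      have i1 : IntervalIntegrable (fun t => bSpline (n + 1) (x + l - t))
          MeasureTheory.volume 0 x := by
        refine (intervalIntegrable_congr e1).2 (Continuous.intervalIntegrable ?_ _ _)
        fun_prop
      have i2 : IntervalIntegrable (fun t => bSpline (n + 1) (x + l - t))
          MeasureTheory.volume x 1 := by
        refine (intervalIntegrable_congr e2).2 (Continuous.intervalIntegrable ?_ _ _)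
        fun_prop
      simp only [bSpline, piece]
      rw [← intervalIntegral.integral_add_adjacent_intervals i1 i2,
        intervalIntegral.integral_congr_ae (Filter.Eventually.of_forall fun t ht => e1 ht),
        intervalIntegral.integral_congr_ae (Filter.Eventually.of_forall fun t ht => e2 ht),
        intervalIntegral.integral_comp_sub_left (fun s => (piece (n + 1) l).eval s),
        intervalIntegral.integral_comp_sub_left (fun s => (piece (n + 1) (l - 1)).eval s),
        integral_eval_eq_antideriv, integral_eval_eq_antideriv]
      simp [eval_zero_antideriv]

theorem piece_eq_zero : ∀ (N : ℕ) (l : ℤ), l < 0 ∨ (N : ℤ) ≤ l → piece N l = 0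
  | 0, _, _ => rfl
  | 1, l, h => by
      simp only [piece]
      rw [if_neg]
      push_cast at h
      omega
  | n + 2, l, h => by
      push_cast at h
      simp only [piece]
      rw [piece_eq_zero (n + 1) l (by push_cast; omega),
        piece_eq_zero (n + 1) (l - 1) (by push_cast; omega)]
      simp [antideriv_zero]

theorem natDegree_piece_le : ∀ (n : ℕ) (l : ℤ), (piece (n + 1) l).natDegree ≤ n
  | 0, l => by simp only [piece]; split_ifs <;> simp
  | n + 1, l => by
      simp only [piece]
      have h (m : ℤ) : (antideriv (piece (n + 1) m)).natDegree ≤ n + 1 :=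
        (natDegree_antideriv_le _).trans (Nat.succ_le_succ (natDegree_piece_le n m))
      refine (natDegree_add_le_of_degree_le (h _) ?_)
      exact (natDegree_sub_le _ _).trans (by simpa using h (l - 1))

theorem derivative_piece (n : ℕ) (l : ℤ) :
    derivative (piece (n + 2) l) = piece (n + 1) l - piece (n + 1) (l - 1) := by
  simp only [piece, derivative_add, derivative_sub, derivative_antideriv, derivative_C]
  ring

theorem antideriv_add (p q : ℝ[X]) : antideriv (p + q) = antideriv p + antideriv q := by
  refine sum_add_index p q _ (fun i => by simp) fun i a b => ?_
  rw [add_div, map_add]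

theorem antideriv_sum {ι : Type*} (s : Finset ι) (p : ι → ℝ[X]) :
    antideriv (∑ i ∈ s, p i) = ∑ i ∈ s, antideriv (p i) :=
  map_sum (⟨⟨antideriv, antideriv_zero⟩, antideriv_add⟩ : ℝ[X] →+ ℝ[X]) p s

/-- The integer translates of a B-spline form a partition of unity. -/
theorem sum_piece : ∀ n : ℕ, ∑ l ∈ Finset.range (n + 1), piece (n + 1) l = 1
  | 0 => by simp [piece]
  | n + 1 => by
      have ih := sum_piece n
      have h1 : ∑ l ∈ Finset.range (n + 2), piece (n + 1) (l : ℤ) = 1 := by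
        rw [Finset.sum_range_succ, ih, piece_eq_zero _ _ (Or.inr (by simp)), add_zero]
      have h2 : ∑ l ∈ Finset.range (n + 2), piece (n + 1) ((l : ℤ) - 1) = 1 := by
        rw [Finset.sum_range_succ', piece_eq_zero _ _ (Or.inl (by simp)), add_zero, ← ih]
        refine Finset.sum_congr rfl fun l _ => ?_
        push_cast; congr 1; ring
      simp only [piece, Finset.sum_add_distrib, Finset.sum_sub_distrib]
      rw [← antideriv_sum, ← map_sum, ← eval_finsetSum, ← antideriv_sum, h1, h2]
      have : antideriv 1 = X := by
        rw [antideriv, ← C_1, sum_C_index (by simp)]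
        simp [monomial_one_one_eq_X]
      rw [this]; simp

/-! ### The polynomial of a spline on a unit interval -/

/-- `∑_{l < N} a_l p_{N,l}`, where `p_{N,l}` is the polynomial of `B_N(· + l)` on `[0, 1)`. -/
noncomputable def pieceComb (N : ℕ) (a : ℤ → ℂ) : ℂ[X] :=
  ∑ l ∈ Finset.range N, C (a l) * (piece N l).map (algebraMap ℝ ℂ)

theorem natDegree_pieceComb_le (n : ℕ) (a : ℤ → ℂ) : (pieceComb (n + 1) a).natDegree ≤ n := by
  refine natDegree_sum_le_of_forall_le _ _ fun l _ => ?_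
  exact (natDegree_C_mul_le _ _).trans (natDegree_map_le.trans (natDegree_piece_le n l))

theorem derivative_pieceComb (n : ℕ) (a : ℤ → ℂ) :
    derivative (pieceComb (n + 2) a) = pieceComb (n + 1) fun l => a l - a (l + 1) := by
  have hz (l : ℤ) (h : l < 0 ∨ ((n + 1 : ℕ) : ℤ) ≤ l) := piece_eq_zero (n + 1) l h
  simp only [pieceComb, derivative_sum, derivative_mul, derivative_C, zero_mul, zero_add,
    derivative_map, derivative_piece, Polynomial.map_sub, mul_sub, Finset.sum_sub_distrib, map_sub,
    sub_mul]
  congr 1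
  · rw [Finset.sum_range_succ, hz _ (Or.inr (by simp))]
    simp
  · rw [Finset.sum_range_succ', hz _ (Or.inl (by simp))]
    simp

/-- The pieces of a B-spline of order `N` are linearly independent: differentiation lowers the
order and turns the coefficients into differences, and constant coefficients are ruled out by the
partition of unity. -/
theorem pieceComb_eq_zero : ∀ (n : ℕ) (a : ℤ → ℂ), pieceComb (n + 1) a = 0 →
    ∀ l ∈ Finset.range (n + 1), a l = 0
  | 0, a, h, l, hl => by
      have hl0 : l = 0 := by simpa using hl
      subst hl0
      simpa [pieceComb, piece] using h
  | n + 1, a, h, l, hl => by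
      have hd : pieceComb (n + 1) (fun l => a l - a (l + 1)) = 0 := by
        rw [← derivative_pieceComb, h, derivative_zero]
      have ih := pieceComb_eq_zero n _ hd
      have hconst : ∀ m : ℕ, m < n + 2 → a m = a 0 := by
        intro m
        induction m with
        | zero => simp
        | succ m im =>
          intro hm
          rw [← im (by omega)]
          have := ih m (Finset.mem_range.2 (by omega))
          push_cast
          exact (sub_eq_zero.1 this).symm
      have h1 : pieceComb (n + 2) a = C (a 0) := by
        rw [pieceComb, Finset.sum_congr rfl fun m hm => by rw [hconst m (Finset.mem_range.1 hm)],
          ← Finset.mul_sum, ← Polynomial.map_sum, sum_piece (n + 1)]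
        simp
      rw [hconst l (Finset.mem_range.1 hl)]
      exact C_eq_zero.1 (h1 ▸ h)

theorem pieceComb_injective {n : ℕ} {a b : ℤ → ℂ} (h : pieceComb (n + 1) a = pieceComb (n + 1) b) :
    ∀ l ∈ Finset.range (n + 1), a l = b l := by
  have h0 : pieceComb (n + 1) (fun l => a l - b l) = 0 := by
    simp only [pieceComb, map_sub, sub_mul, Finset.sum_sub_distrib] at h ⊢
    rw [h, sub_self]
  exact fun l hl => sub_eq_zero.1 (pieceComb_eq_zero n _ h0 l hl)

theorem C_mul_pieceComb (N : ℕ) (z : ℂ) (a : ℤ → ℂ) :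
    C z * pieceComb N a = pieceComb N fun l => z * a l := by
  simp only [pieceComb, Finset.mul_sum, C_mul, mul_assoc]

theorem map_conj_pieceComb (N : ℕ) (a : ℤ → ℂ) :
    (pieceComb N a).map (starRingEnd ℂ) = pieceComb N fun l => conj (a l) := by
  simp only [pieceComb, Polynomial.map_sum, Polynomial.map_mul, map_C, Polynomial.map_map]
  refine Finset.sum_congr rfl fun l _ => ?_
  congr 2
  ext x
  simp

/-- On `[j, j + 1)` only the coefficients `c_{j-N+1}, …, c_j` contribute to a spline. -/
theorem splineSum_add_int (N : ℕ) (c : ℤ → ℂ) (j : ℤ) {x : ℝ} (hx : x ∈ Set.Ico (0 : ℝ) 1) :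
    splineSum N c (x + j) = (pieceComb N fun l => c (j - l)).eval (x : ℂ) := by
  rw [splineSum, ← (Equiv.subLeft j).tsum_eq]
  have h (l : ℤ) : c (j - l) * (bSpline N (x + j - ((j - l : ℤ) : ℝ)) : ℂ) =
      c (j - l) * (((piece N l).eval x : ℝ) : ℂ) := by
    rw [← bSpline_add_int N l x hx]
    congr 3; push_cast; ring
  simp only [Equiv.subLeft_apply, h]
  rw [tsum_eq_sum (s := (Finset.range N).map Nat.castEmbedding), Finset.sum_map, pieceComb,
    eval_finsetSum]
  · refine Finset.sum_congr rfl fun l _ => ?_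
    have := eval_map_algebraMap (piece N l) (x : ℂ)
    simp only [Nat.castEmbedding_apply, eval_mul, eval_C, this]
    congr 1
    exact (aeval_algebraMap_apply_eq_algebraMap_eval x (piece N l)).symm
  · intro l hl
    rw [piece_eq_zero N l]
    · simp
    · by_contra! hcon
      refine hl (Finset.mem_map.2 ⟨l.toNat, Finset.mem_range.2 (by omega), ?_⟩)
      simp [hcon.1]

theorem deriv_splineSum_add_int (N : ℕ) (c : ℤ → ℂ) (j : ℤ) {x : ℝ} (hx : x ∈ Set.Ioo (0 : ℝ) 1) :
    deriv (splineSum N c) (x + j) =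
      (derivative (pieceComb N fun l => c (j - l))).eval (x : ℂ) := by
  set P := pieceComb N fun l => c (j - l)
  have hP : HasDerivAt (fun y : ℝ => P.eval (y : ℂ)) ((derivative P).eval (x : ℂ)) (x + j - j) := by
    rw [add_sub_cancel_right]
    exact (P.hasDerivAt (x : ℂ)).comp_ofReal
  have hP' := hP.comp_sub_const (x + j) (j : ℝ)
  refine (hP'.congr_of_eventuallyEq ?_).deriv
  have hopen : Set.Ioo (j : ℝ) (j + 1) ∈ nhds (x + j) :=
    Ioo_mem_nhds (by linarith [hx.1]) (by linarith [hx.2])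
  filter_upwards [hopen] with y hy
  have := splineSum_add_int N c j (x := y - j) ⟨by linarith [hy.1], by linarith [hy.2]⟩
  rwa [sub_add_cancel] at this

/-! ### Phase retrieval for polynomials on the real line -/

/-- The polynomial whose coefficients are the conjugates of those of `P`; on the real line it
takes the conjugate values. -/
noncomputable def conjPoly (P : ℂ[X]) : ℂ[X] := P.map (starRingEnd ℂ)

theorem conjPoly_conjPoly (P : ℂ[X]) : conjPoly (conjPoly P) = P := by
  ext n
  simp [conjPoly]

theorem conjPoly_eq_zero {P : ℂ[X]} : conjPoly P = 0 ↔ P = 0 :=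
  Polynomial.map_eq_zero _

theorem natDegree_conjPoly_le {P : ℂ[X]} {n : ℕ} (h : P.natDegree ≤ n) :
    (conjPoly P).natDegree ≤ n :=
  natDegree_map_le.trans h

theorem derivative_conjPoly (P : ℂ[X]) : derivative (conjPoly P) = conjPoly (derivative P) :=
  derivative_map P _

theorem eval_conjPoly (P : ℂ[X]) (x : ℝ) : (conjPoly P).eval (x : ℂ) = conj (P.eval (x : ℂ)) := by
  conv_lhs => rw [conjPoly, ← Complex.conj_ofReal x, eval_map, eval₂_hom]

theorem eval_mul_conjPoly (P : ℂ[X]) (x : ℝ) :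
    (P * conjPoly P).eval (x : ℂ) = ((‖P.eval (x : ℂ)‖ ^ 2 : ℝ) : ℂ) := by
  rw [eval_mul, eval_conjPoly, Complex.mul_conj, Complex.normSq_eq_norm_sq]

theorem eq_of_natDegree_lt_of_eval_eq {A B : ℂ[X]} {n : ℕ} (hA : (A - B).natDegree < n)
    (S : Finset ℝ) (hS : S.card = n) (h : ∀ x ∈ S, A.eval (x : ℂ) = B.eval (x : ℂ)) : A = B := by
  rw [← sub_eq_zero]
  refine eq_zero_of_natDegree_lt_card_of_eval_eq_zero' (A - B)
    (S.map ⟨((↑) : ℝ → ℂ), Complex.ofReal_injective⟩) ?_ (by rwa [Finset.card_map, hS])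
  intro x hx
  obtain ⟨y, hy, rfl⟩ := Finset.mem_map.1 hx
  simpa [sub_eq_zero] using h y hy

theorem coeff_mul_subleading {P Q : ℂ[X]} {n : ℕ} (hP : P.natDegree ≤ n + 1)
    (hQ : Q.natDegree ≤ n + 1) :
    (P * Q).coeff (2 * n + 1) = P.coeff (n + 1) * Q.coeff n + P.coeff n * Q.coeff (n + 1) := by
  rw [coeff_mul, ← Finset.sum_subset (s₁ := {(n + 1, n), (n, n + 1)}),
    Finset.sum_pair (by simp)]
  · intro x hx
    simp only [Finset.mem_insert, Finset.mem_singleton] at hx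
    rcases hx with rfl | rfl <;> simp <;> omega
  · rintro ⟨i, j⟩ hij hx
    simp only [Finset.mem_insert, Finset.mem_singleton, Prod.mk.injEq,
      Finset.HasAntidiagonal.mem_antidiagonal] at hij hx
    rcases lt_or_ge (n + 1) i with hi | hi
    · rw [coeff_eq_zero_of_natDegree_lt (hP.trans_lt hi), zero_mul]
    · rw [coeff_eq_zero_of_natDegree_lt (p := Q) (hQ.trans_lt (by omega)), mul_zero]

/-- The product `P P̄` fixes the two leading coefficients of `P' P̄'`, which is why two samples of
the derivative can be saved. -/
theorem natDegree_derivative_mul_sub_le {P Q : ℂ[X]} {n : ℕ} (hP : P.natDegree ≤ n + 2)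
    (hQ : Q.natDegree ≤ n + 2) (h : P * conjPoly P = Q * conjPoly Q) :
    (derivative P * conjPoly (derivative P) -
      derivative Q * conjPoly (derivative Q)).natDegree ≤ 2 * n := by
  have hd {R : ℂ[X]} (hR : R.natDegree ≤ n + 2) : (derivative R).natDegree ≤ n + 1 :=
    (natDegree_derivative_le R).trans (by omega)
  have top {R : ℂ[X]} (hR : R.natDegree ≤ n + 2) :
      (derivative R * conjPoly (derivative R)).coeff (n + 1 + (n + 1)) =
        (n + 2) ^ 2 * (R * conjPoly R).coeff (n + 2 + (n + 2)) := by
    rw [coeff_mul_add_eq_of_natDegree_le (hd hR) (natDegree_conjPoly_le (hd hR)),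
      coeff_mul_add_eq_of_natDegree_le hR (natDegree_conjPoly_le hR)]
    simp only [conjPoly, coeff_map, coeff_derivative, map_mul, map_add, map_natCast, map_one]
    push_cast; ring
  have sub {R : ℂ[X]} (hR : R.natDegree ≤ n + 2) :
      (derivative R * conjPoly (derivative R)).coeff (2 * n + 1) =
        (n + 1) * (n + 2) * (R * conjPoly R).coeff (2 * (n + 1) + 1) := by
    rw [coeff_mul_subleading (hd hR) (natDegree_conjPoly_le (hd hR)),
      coeff_mul_subleading hR (natDegree_conjPoly_le hR)]
    simp only [conjPoly, coeff_map, coeff_derivative, map_mul, map_add, map_natCast, map_one]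
    push_cast; ring
  rw [natDegree_le_iff_coeff_eq_zero]
  intro m hm
  rw [coeff_sub, sub_eq_zero]
  rcases (by omega : m = 2 * n + 1 ∨ m = n + 1 + (n + 1) ∨ n + 1 + (n + 1) < m) with
    rfl | rfl | hm'
  · rw [sub hP, sub hQ, h]
  · rw [top hP, top hQ, h]
  · have big {R : ℂ[X]} (hR : R.natDegree ≤ n + 2) :
        (derivative R * conjPoly (derivative R)).coeff m = 0 :=
      coeff_eq_zero_of_natDegree_lt
        ((natDegree_mul_le_of_le (hd hR) (natDegree_conjPoly_le (hd hR))).trans_lt hm')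
    rw [big hP, big hQ]

/-- A vanishing Wronskian means proportionality. Subtracting a multiple of `P` from `Q` one may
assume that `Q` has no term of degree `deg P`, while comparing leading coefficients in
`Q' P = P' Q` gives `deg Q = deg P` unless `Q = 0`. -/
theorem exists_eq_C_mul_of_derivative_mul_eq {P Q : ℂ[X]} (hP : P ≠ 0)
    (h : derivative Q * P = derivative P * Q) : ∃ z : ℂ, Q = C z * P := by
  set z := Q.coeff P.natDegree / P.leadingCoeff
  refine ⟨z, ?_⟩
  have hlP : P.leadingCoeff ≠ 0 := leadingCoeff_ne_zero.2 hP
  rw [← sub_eq_zero]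
  set R := Q - C z * P
  by_contra hR
  have hRP : derivative R * P = derivative P * R := by
    simp only [R, derivative_sub, derivative_C_mul, sub_mul, mul_sub, h]
    ring
  have hR0 : R.coeff P.natDegree = 0 := by
    simp only [R, coeff_sub, coeff_C_mul, coeff_natDegree, z]
    rw [div_mul_cancel₀ _ hlP, sub_self]
  have hdX (S : ℂ[X]) : (X * derivative S).natDegree ≤ S.natDegree := by
    rw [natDegree_le_iff_coeff_eq_zero]
    intro m hm
    cases m with
    | zero => simp
    | succ m => simp [coeff_X_mul, coeff_derivative, coeff_eq_zero_of_natDegree_lt hm]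
  have hcX (S : ℂ[X]) (m : ℕ) : (X * derivative S).coeff m = m * S.coeff m := by
    cases m with
    | zero => simp
    | succ m => simp [coeff_X_mul, coeff_derivative, mul_comm]
  have key : (X * derivative R * P).coeff (R.natDegree + P.natDegree) =
      (R * (X * derivative P)).coeff (R.natDegree + P.natDegree) := by
    congr 1
    linear_combination X * hRP
  rw [coeff_mul_add_eq_of_natDegree_le (hdX R) le_rfl,
    coeff_mul_add_eq_of_natDegree_le le_rfl (hdX P), hcX, hcX, coeff_natDegree,
    coeff_natDegree] at key
  have hlR : R.leadingCoeff ≠ 0 := leadingCoeff_ne_zero.2 hR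
  have hdeg : (R.natDegree : ℂ) = P.natDegree :=
    mul_right_cancel₀ (mul_ne_zero hlR hlP) (by linear_combination key)
  rw [← Nat.cast_injective hdeg, coeff_natDegree] at hR0
  exact hlR hR0

theorem exists_unimodular_of_mul_conjPoly_eq {P Q : ℂ[X]} (h : Q * conjPoly Q = P * conjPoly P)
    (hd : derivative Q * conjPoly Q = derivative P * conjPoly P) :
    ∃ z : ℂ, ‖z‖ = 1 ∧ Q = C z * P := by
  by_cases hP : P = 0
  · refine ⟨1, norm_one, ?_⟩
    rw [hP, zero_mul, mul_eq_zero, conjPoly_eq_zero, or_self] at h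
    rw [h, hP, mul_zero]
  have hPP : P * conjPoly P ≠ 0 := mul_ne_zero hP (mt conjPoly_eq_zero.1 hP)
  have hQ : conjPoly Q ≠ 0 := fun h0 => hPP (by rw [← h, h0, mul_zero])
  obtain ⟨z, hz⟩ := exists_eq_C_mul_of_derivative_mul_eq (P := P) (Q := Q) hP
    (mul_right_cancel₀ hQ (by linear_combination P * hd - derivative P * h))
  refine ⟨z, ?_, hz⟩
  have hzz : C (z * conj z) * (P * conjPoly P) = C 1 * (P * conjPoly P) := by
    have : conjPoly Q = C (conj z) * conjPoly P := by
      simp only [hz, conjPoly, Polynomial.map_mul, map_C]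
    rw [C_mul, C_1]
    linear_combination h - C (conj z) * conjPoly P * hz - Q * this
  have h1 := C_injective (mul_right_cancel₀ hPP hzz)
  rw [Complex.mul_conj, Complex.normSq_eq_norm_sq] at h1
  have h2 : ‖z‖ ^ 2 = 1 := by exact_mod_cast h1
  exact (pow_eq_one_iff_of_nonneg (norm_nonneg z) two_ne_zero).1 h2

/-- The products `P' P̄` and `P P̄'` have sum `(P P̄)'` and product `P P̄ · P' P̄'`. Two
polynomials with the same `P P̄` and `P' P̄'` therefore share this pair up to order, and the two
orders correspond to `P` and to its conjugate. -/
theorem exists_unimodular_or_conj {P Q : ℂ[X]} (h : Q * conjPoly Q = P * conjPoly P)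
    (hd : derivative Q * conjPoly (derivative Q) = derivative P * conjPoly (derivative P)) :
    ∃ z : ℂ, ‖z‖ = 1 ∧ (Q = C z * P ∨ Q = C z * conjPoly P) := by
  have hsum := congrArg derivative h
  simp only [derivative_mul, derivative_conjPoly] at hsum
  have hfac : (derivative Q * conjPoly Q - derivative P * conjPoly P) *
      (derivative Q * conjPoly Q - P * conjPoly (derivative P)) = 0 := by
    linear_combination (derivative Q * conjPoly Q) * hsum
      - (derivative Q * conjPoly (derivative Q)) * h - (P * conjPoly P) * hd
  rcases mul_eq_zero.1 hfac with h1 | h1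
  · obtain ⟨z, hz, hQ⟩ := exists_unimodular_of_mul_conjPoly_eq h (sub_eq_zero.1 h1)
    exact ⟨z, hz, Or.inl hQ⟩
  · obtain ⟨z, hz, hQ⟩ := exists_unimodular_of_mul_conjPoly_eq (P := conjPoly P) (Q := Q)
      (by rw [h, conjPoly_conjPoly, mul_comm])
      (by rw [conjPoly_conjPoly, derivative_conjPoly, mul_comm (conjPoly _)]
          exact sub_eq_zero.1 h1)
    exact ⟨z, hz, Or.inr hQ⟩

theorem exists_unimodular_or_conj_of_norm_eval_eq {P Q : ℂ[X]} {n : ℕ} (hP : P.natDegree ≤ n + 2)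
    (hQ : Q.natDegree ≤ n + 2) {S T : Finset ℝ} (hS : S.card = 2 * n + 5)
    (hT : T.card = 2 * n + 1) (hv : ∀ x ∈ S, ‖Q.eval (x : ℂ)‖ = ‖P.eval (x : ℂ)‖)
    (hd : ∀ x ∈ T, ‖(derivative Q).eval (x : ℂ)‖ = ‖(derivative P).eval (x : ℂ)‖) :
    ∃ z : ℂ, ‖z‖ = 1 ∧ (Q = C z * P ∨ Q = C z * conjPoly P) := by
  have h : Q * conjPoly Q = P * conjPoly P := by
    have hb {R : ℂ[X]} (hR : R.natDegree ≤ n + 2) : (R * conjPoly R).natDegree ≤ 2 * n + 4 :=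
      (natDegree_mul_le_of_le hR (natDegree_conjPoly_le hR)).trans (by omega)
    refine eq_of_natDegree_lt_of_eval_eq (n := 2 * n + 5) ?_ S hS fun x hx => ?_
    · exact Nat.lt_succ_of_le (natDegree_sub_le_of_le (hb hQ) (hb hP) |>.trans (by simp))
    · rw [eval_mul_conjPoly, eval_mul_conjPoly, hv x hx]
  refine exists_unimodular_or_conj h ?_
  refine eq_of_natDegree_lt_of_eval_eq (n := 2 * n + 1)
    (Nat.lt_succ_of_le (natDegree_derivative_mul_sub_le hQ hP h)) T hT fun x hx => ?_
  rw [eval_mul_conjPoly, eval_mul_conjPoly, hd x hx]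

/-! ### Real collinearity of coefficients -/

/-- The values of `c` on `s` lie on one real line through the origin of `ℂ`. -/
def Collin (c : ℤ → ℂ) (s : Set ℤ) : Prop :=
  ∀ k ∈ s, ∀ l ∈ s, (c k * conj (c l)).im = 0

theorem im_mul_conj_eq_zero {ξ a b : ℂ} (hξ : ‖ξ‖ = 1) (ha : (conj ξ * a).im = 0)
    (hb : (conj ξ * b).im = 0) : (a * conj b).im = 0 := by
  have h1 : conj ξ * ξ = 1 := by
    rw [mul_comm, Complex.mul_conj, Complex.normSq_eq_norm_sq, hξ]; simp
  have : a * conj b = (conj ξ * a) * conj (conj ξ * b) := by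
    rw [map_mul, Complex.conj_conj]
    linear_combination -(a * conj b) * h1
  rw [this, Complex.mul_im, Complex.conj_im, Complex.conj_re, ha, hb]
  ring

/-- A nonzero vector of the line `ξ ℝ` spans it. -/
theorem im_conj_mul_eq_zero {ξ a b : ℂ} (hξ : ‖ξ‖ = 1) (ha : (conj ξ * a).im = 0) (ha0 : a ≠ 0)
    (h : (a * conj b).im = 0) : (conj ξ * b).im = 0 := by
  have h1 : conj ξ * ξ = 1 := by
    rw [mul_comm, Complex.mul_conj, Complex.normSq_eq_norm_sq, hξ]; simp
  have e : a * conj b = (conj ξ * a) * conj (conj ξ * b) := by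
    rw [map_mul, Complex.conj_conj]
    linear_combination -(a * conj b) * h1
  have hre : (conj ξ * a).re ≠ 0 := by
    intro hre
    have h0 : conj ξ * a = 0 := Complex.ext hre ha
    refine ha0 ((mul_eq_zero.1 h0).resolve_left ?_)
    intro h2
    rw [h2, zero_mul] at h1
    exact zero_ne_one h1
  rw [e, Complex.mul_im, Complex.conj_im, Complex.conj_re, ha, zero_mul, add_zero, mul_neg,
    neg_eq_zero, mul_eq_zero] at h
  exact h.resolve_left hre

theorem collin_of_forall_im {c : ℤ → ℂ} {s : Set ℤ} {ξ : ℂ} (hξ : ‖ξ‖ = 1)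
    (h : ∀ l ∈ s, (conj ξ * c l).im = 0) : Collin c s :=
  fun k hk l hl => im_mul_conj_eq_zero hξ (h k hk) (h l hl)

theorem conj_mul_eq_of_im_eq_zero {a b : ℂ} (h : (a * conj b).im = 0) :
    conj a * b = a * conj b := by
  have := Complex.conj_eq_iff_im.2 h
  rwa [map_mul, Complex.conj_conj] at this

/-- On a collinear window conjugation is multiplication by a unimodular constant. -/
theorem Collin.exists_unimodular {c d : ℤ → ℂ} {s : Set ℤ} (hc : Collin c s) {w : ℂ}
    (hw : ‖w‖ = 1) (hd : ∀ k ∈ s, d k = w * conj (c k)) :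
    ∃ z : ℂ, ‖z‖ = 1 ∧ ∀ k ∈ s, d k = z * c k := by
  by_cases h : ∃ l ∈ s, c l ≠ 0
  · obtain ⟨l, hl, hl0⟩ := h
    refine ⟨w * (conj (c l) / c l), ?_, fun k hk => ?_⟩
    · rw [norm_mul, norm_div, Complex.norm_conj, hw, div_self (norm_ne_zero_iff.2 hl0), one_mul]
    · rw [hd k hk]
      have := conj_mul_eq_of_im_eq_zero (hc k hk l hl)
      field_simp
      linear_combination w * this
  · push Not at h
    refine ⟨1, norm_one, fun k hk => ?_⟩
    rw [hd k hk, h k hk]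
    simp

/-- Two sequences related on `s` both directly and through conjugation are collinear there. -/
theorem collin_of_mul_eq_mul_conj {c : ℤ → ℂ} {s : Set ℤ} {z w : ℂ} (hz : ‖z‖ = 1) (hw : ‖w‖ = 1)
    (h : ∀ k ∈ s, z * c k = w * conj (c k)) : Collin c s := by
  have hu {v : ℂ} (hv : ‖v‖ = 1) : v * conj v = 1 := by
    rw [Complex.mul_conj, Complex.normSq_eq_norm_sq, hv]; simp
  intro k hk l hl
  rw [← Complex.conj_eq_iff_im, map_mul, Complex.conj_conj]
  have hl' := congrArg conj (h l hl)
  simp only [map_mul, Complex.conj_conj] at hl'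
  linear_combination (c k * conj (c l)) * hu hz - (conj (c k) * c l) * hu hw
    - conj z * conj (c l) * h k hk - w * conj (c k) * hl'

/-! ### Gluing the local phases -/

/-- If every window of `M + 1` consecutive indices carries a constant `z` with `d = z c`, then one
constant serves all indices, provided that `c` vanishes on `M` consecutive indices only where it
vanishes to one side as well. -/
theorem exists_global_phase {M : ℕ} {c d : ℤ → ℂ}
    (hloc : ∀ j : ℤ, ∃ z : ℂ, ‖z‖ = 1 ∧ ∀ k ∈ Set.Icc (j - M) j, d k = z * c k)
    (hgap : ∀ j : ℤ, (∀ k ∈ Set.Icc (j - M + 1) j, c k = 0) →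
      (∀ k ≤ j, c k = 0) ∨ ∀ k ≥ j - M + 1, c k = 0) :
    ∃ z : ℂ, ‖z‖ = 1 ∧ ∀ k, d k = z * c k := by
  by_cases hc : ∀ k, c k = 0
  · refine ⟨1, norm_one, fun k => ?_⟩
    obtain ⟨z, -, hz⟩ := hloc k
    rw [hz k ⟨by omega, le_rfl⟩, hc k, mul_zero, mul_zero]
  push Not at hc
  obtain ⟨k₀, hk₀⟩ := hc
  obtain ⟨z, hz1, hz⟩ := hloc k₀
  have eq_of {w : ℂ} {s t : Set ℤ} (hs : ∀ k ∈ s, d k = z * c k) (ht : ∀ k ∈ t, d k = w * c k)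
      {k : ℤ} (hks : k ∈ s) (hkt : k ∈ t) (hk : c k ≠ 0) : w = z :=
    mul_right_cancel₀ hk ((ht k hkt).symm.trans (hs k hks))
  have up : ∀ j ≥ k₀, ∀ k ∈ Set.Icc (j - M) j, d k = z * c k := by
    refine fun j hj => Int.leInduction hz (fun j hj ih => ?_) j hj
    obtain ⟨w, -, hw⟩ := hloc (j + 1)
    by_cases h0 : ∀ k ∈ Set.Icc (j - M + 1) j, c k = 0
    · rcases hgap j h0 with h | h
      · exact absurd (h k₀ hj) hk₀
      · intro k hk
        rw [hw k hk, h k (by have := hk.1; omega), mul_zero, mul_zero]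
    · push Not at h0
      obtain ⟨k, hk, hk0⟩ := h0
      have : w = z := eq_of ih hw (k := k) ⟨by have := hk.1; omega, hk.2⟩
        ⟨by have := hk.1; omega, by have := hk.2; omega⟩ hk0
      exact this ▸ hw
  have down : ∀ j ≤ k₀, ∀ k ∈ Set.Icc (j - M) j, d k = z * c k := by
    refine fun j hj => Int.leInductionDown hz (fun j hj ih => ?_) j hj
    obtain ⟨w, -, hw⟩ := hloc (j - 1)
    by_cases h0 : ∀ k ∈ Set.Icc (j - 1 - M + 1) (j - 1), c k = 0
    · rcases hgap (j - 1) h0 with h | h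
      · intro k hk
        rw [hw k hk, h k hk.2, mul_zero, mul_zero]
      · exact absurd (h k₀ (by omega)) hk₀
    · push Not at h0
      obtain ⟨k, hk, hk0⟩ := h0
      have : w = z := eq_of ih hw (k := k) ⟨by have := hk.1; omega, by have := hk.2; omega⟩
        ⟨by have := hk.1; omega, hk.2⟩ hk0
      exact this ▸ hw
  refine ⟨z, hz1, fun k => ?_⟩
  rcases le_total k₀ k with h | h
  · exact up k h k ⟨by omega, le_rfl⟩
  · exact down k h k ⟨by omega, le_rfl⟩

/-- If one non-collinear window is related directly, then all windows are: the direct relation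
spreads through non-collinear overlaps, and on collinear windows it is free. -/
theorem forall_direct_of_direct {M : ℕ} {c d : ℤ → ℂ}
    (hloc : ∀ j : ℤ, ∃ z : ℂ, ‖z‖ = 1 ∧ ((∀ k ∈ Set.Icc (j - M) j, d k = z * c k) ∨
      ∀ k ∈ Set.Icc (j - M) j, d k = z * conj (c k)))
    (hnc : ∀ a b : ℤ, ¬ Collin c (Set.Icc (a - M) a) → ¬ Collin c (Set.Icc (b - M) b) →
      ∀ k, a ≤ k → k < b → ¬ Collin c (Set.Icc (k - M + 1) k))
    {j₀ : ℤ} (hj₀ : ¬ Collin c (Set.Icc (j₀ - M) j₀))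
    (hdir : ∃ z : ℂ, ‖z‖ = 1 ∧ ∀ k ∈ Set.Icc (j₀ - M) j₀, d k = z * c k) (j : ℤ) :
    ∃ z : ℂ, ‖z‖ = 1 ∧ ∀ k ∈ Set.Icc (j - M) j, d k = z * c k := by
  by_cases hj : Collin c (Set.Icc (j - M) j)
  · obtain ⟨z, hz, h | h⟩ := hloc j
    · exact ⟨z, hz, h⟩
    · exact hj.exists_unimodular hz h
  have step {i i' k : ℤ} (hk : ¬ Collin c (Set.Icc (k - M + 1) k)) (h1 : i - M ≤ k - M + 1)
      (h2 : k ≤ i) (h1' : i' - M ≤ k - M + 1) (h2' : k ≤ i')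
      (hi : ∃ z : ℂ, ‖z‖ = 1 ∧ ∀ k ∈ Set.Icc (i - M) i, d k = z * c k) :
      ∃ z : ℂ, ‖z‖ = 1 ∧ ∀ k ∈ Set.Icc (i' - M) i', d k = z * c k := by
    obtain ⟨z, hz, h⟩ := hi
    obtain ⟨w, hw, h' | h'⟩ := hloc i'
    · exact ⟨w, hw, h'⟩
    · refine absurd (collin_of_mul_eq_mul_conj hz hw fun l hl => ?_) hk
      rw [← h l ⟨h1.trans hl.1, hl.2.trans h2⟩, h' l ⟨h1'.trans hl.1, hl.2.trans h2'⟩]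
  rcases le_total j₀ j with hle | hle
  · have : ∀ i ≥ j₀, i ≤ j → ∃ z : ℂ, ‖z‖ = 1 ∧ ∀ k ∈ Set.Icc (i - M) i, d k = z * c k := by
      refine fun i hi => Int.leInduction (fun _ => hdir) (fun i hi ih hij => ?_) i hi
      exact step (hnc j₀ j hj₀ hj i hi (by omega)) (by omega) le_rfl (by omega) (by omega)
        (ih (by omega))
    exact this j hle le_rfl
  · have : ∀ i ≤ j₀, j ≤ i → ∃ z : ℂ, ‖z‖ = 1 ∧ ∀ k ∈ Set.Icc (i - M) i, d k = z * c k := by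
      refine fun i hi => Int.leInductionDown (fun _ => hdir) (fun i hi ih hij => ?_) i hi
      exact step (hnc j j₀ hj hj₀ (i - 1) (by omega) (by omega)) (by omega) (by omega) (by omega)
        le_rfl (ih (by omega))
    exact this j hle le_rfl

theorem exists_global_phase_or_conj {M : ℕ} {c d : ℤ → ℂ}
    (hloc : ∀ j : ℤ, ∃ z : ℂ, ‖z‖ = 1 ∧ ((∀ k ∈ Set.Icc (j - M) j, d k = z * c k) ∨
      ∀ k ∈ Set.Icc (j - M) j, d k = z * conj (c k)))
    (hgap : ∀ j : ℤ, (∀ k ∈ Set.Icc (j - M + 1) j, c k = 0) →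
      (∀ k ≤ j, c k = 0) ∨ ∀ k ≥ j - M + 1, c k = 0)
    (hnc : ∀ a b : ℤ, ¬ Collin c (Set.Icc (a - M) a) → ¬ Collin c (Set.Icc (b - M) b) →
      ∀ k, a ≤ k → k < b → ¬ Collin c (Set.Icc (k - M + 1) k)) :
    ∃ z : ℂ, ‖z‖ = 1 ∧ ((∀ k, d k = z * c k) ∨ ∀ k, d k = z * conj (c k)) := by
  by_cases hall : ∀ j : ℤ, Collin c (Set.Icc (j - M) j)
  · obtain ⟨z, hz, h⟩ := exists_global_phase (d := d) (fun j => by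
      obtain ⟨z, hz, h | h⟩ := hloc j
      · exact ⟨z, hz, h⟩
      · exact (hall j).exists_unimodular hz h) hgap
    exact ⟨z, hz, Or.inl h⟩
  push Not at hall
  obtain ⟨j₀, hj₀⟩ := hall
  obtain ⟨z, hz, h | h⟩ := hloc j₀
  · obtain ⟨z, hz, h⟩ := exists_global_phase
      (forall_direct_of_direct hloc hnc hj₀ ⟨z, hz, h⟩) hgap
    exact ⟨z, hz, Or.inl h⟩
  · -- Replacing `d` by its conjugate exchanges the two kinds of relation.
    have conj_eq {w u v : ℂ} (huv : u = w * v) : conj u = conj w * conj v := by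
      rw [huv, map_mul]
    have hloc' : ∀ j : ℤ, ∃ z : ℂ, ‖z‖ = 1 ∧
        ((∀ k ∈ Set.Icc (j - M) j, conj (d k) = z * c k) ∨
          ∀ k ∈ Set.Icc (j - M) j, conj (d k) = z * conj (c k)) := by
      intro j
      obtain ⟨w, hw, h' | h'⟩ := hloc j
      · exact ⟨conj w, by rwa [Complex.norm_conj], Or.inr fun k hk => conj_eq (h' k hk)⟩
      · refine ⟨conj w, by rwa [Complex.norm_conj], Or.inl fun k hk => ?_⟩
        rw [conj_eq (h' k hk), Complex.conj_conj]
    obtain ⟨w, hw, h'⟩ := exists_global_phase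
      (forall_direct_of_direct hloc' hnc hj₀
        ⟨conj z, by rwa [Complex.norm_conj], fun k hk => by
          rw [conj_eq (h k hk), Complex.conj_conj]⟩) hgap
    refine ⟨conj w, by rwa [Complex.norm_conj], Or.inr fun k => ?_⟩
    rw [← conj_eq (h' k), Complex.conj_conj]

/-! ### The two coefficient conditions in terms of integers -/

theorem toE_le_toE {k l : ℤ} : toE k ≤ toE l ↔ k ≤ l := by
  simp [toE]

theorem toE_lt_toE {k l : ℤ} : toE k < toE l ↔ k < l := by
  simp [toE]

theorem toE_add_one (k : ℤ) : toE k + 1 = toE (k + 1) := by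
  simp [toE]

theorem eq_zero_of_condI {M : ℕ} {c : ℤ → ℂ} (h : CondI (M + 1) c) (j : ℤ)
    (h0 : ∀ k ∈ Set.Icc (j - M + 1) j, c k = 0) :
    (∀ k ≤ j, c k = 0) ∨ ∀ k ≥ j - M + 1, c k = 0 := by
  have hsum : ∑ l ∈ Finset.range (M + 1 - 1), ‖c (j - M + 1 + l)‖ = 0 := by
    refine Finset.sum_eq_zero fun l hl => ?_
    have hl' := Finset.mem_range.1 hl
    rw [h0 _ ⟨by omega, by omega⟩, norm_zero]
  by_cases h1 : KMinus c - ((((M + 1 : ℕ) : ℝ) - 1 : ℝ) : EReal) < toE (j - M + 1)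
  · right
    have h2 : ¬ toE (j - M + 1) < KPlus c + 1 := fun h2 => h _ h1 h2 hsum
    intro k hk
    by_contra hck
    have h3 : toE k ≤ KPlus c := le_sSup ⟨k, hck, rfl⟩
    refine h2 (lt_of_lt_of_le ?_ (add_le_add_left h3 1))
    rw [toE_add_one, toE_lt_toE]
    omega
  · left
    intro k hk
    by_contra hck
    have h3 : KMinus c ≤ toE k := sInf_le ⟨k, hck, rfl⟩
    refine h1 (lt_of_le_of_lt (EReal.sub_le_sub h3 le_rfl) ?_)
    rw [toE, toE, ← EReal.coe_sub, EReal.coe_lt_coe_iff]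
    have : (k : ℝ) ≤ j := by exact_mod_cast hk
    push_cast
    linarith

theorem toE_le_kappaMinus_iff {c : ℤ → ℂ} {ξ : ℂ} {k : ℤ} :
    toE k ≤ kappaMinus c ξ ↔ ∀ l ≤ k, (conj ξ * c l).im = 0 := by
  refine ⟨fun h l hl => ?_, fun h => le_sSup ⟨k, h, rfl⟩⟩
  have h1 : toE (k - 1) < sSup (toE '' {k | ∀ l ≤ k, (conj ξ * c l).im = 0}) :=
    (toE_lt_toE.2 (by omega)).trans_le h
  obtain ⟨_, ⟨m, hm, rfl⟩, hkm⟩ := lt_sSup_iff.1 h1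
  exact hm l (by have := toE_lt_toE.1 hkm; omega)

theorem kappaMinus_add_one_le {c : ℤ → ℂ} {ξ : ℂ} {k : ℤ} (h : kappaMinus c ξ < toE k) :
    kappaMinus c ξ + 1 ≤ toE k := by
  have h1 : kappaMinus c ξ ≤ toE (k - 1) := by
    refine sSup_le ?_
    rintro _ ⟨m, hm, rfl⟩
    have := (toE_le_kappaMinus_iff.2 hm).trans_lt h
    rw [toE_lt_toE] at this
    exact toE_le_toE.2 (by omega)
  refine (add_le_add_left h1 1).trans ?_
  rw [toE_add_one, sub_add_cancel]

/-- Condition (ii) makes non-collinearity propagate: between two non-collinear windows of `M + 1`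
indices all windows of `M` indices are non-collinear. If there is a middle part this is what the
condition asserts. Otherwise the two lines `ξ₁ ℝ` and `ξ₂ ℝ` meet at an index `q`, and each of these
windows contains `q` as well as an earlier index with a nonzero coefficient in `ξ₁ ℝ`. -/
theorem not_collin_of_condII {M : ℕ} {c : ℤ → ℂ} {ξ₁ ξ₂ : ℂ} (hξ₁ : ‖ξ₁‖ = 1) (hξ₂ : ‖ξ₂‖ = 1)
    (h : CondII (M + 1) c ξ₁ ξ₂) (a b : ℤ) (ha : ¬ Collin c (Set.Icc (a - M) a))
    (hb : ¬ Collin c (Set.Icc (b - M) b)) (k : ℤ) (hak : a ≤ k) (hkb : k < b) :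
    ¬ Collin c (Set.Icc (k - M + 1) k) := by
  have ha' : kappaMinus c ξ₁ < toE a := by
    by_contra hcon
    exact ha (collin_of_forall_im hξ₁ fun l hl =>
      toE_le_kappaMinus_iff.1 (not_lt.1 hcon) l hl.2)
  have hb' : ∀ q : ℤ, (∀ l ≥ q, (conj ξ₂ * c l).im = 0) → b - M + 1 ≤ q := by
    intro q hq
    by_contra hcon
    exact hb (collin_of_forall_im hξ₂ fun l hl => hq l (by have := hl.1; omega))
  intro hk
  by_cases hmid : (middleSet c ξ₁ ξ₂).Nonempty
  · refine h hmid k ?_ ?_ (Finset.sum_eq_zero fun p hp => ?_)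
    · exact (kappaMinus_add_one_le ha').trans (toE_le_toE.2 hak)
    · have h1 : toE (b - M + 1) ≤ kappaPlus c ξ₁ ξ₂ := by
        refine le_sInf ?_
        rintro _ ⟨q, hq, rfl⟩
        exact toE_le_toE.2 (hb' q hq.2)
      refine le_trans ?_ (add_le_add_left h1 _)
      rw [toE, toE, ← EReal.coe_add, EReal.coe_le_coe_iff]
      have : (k : ℝ) + 1 ≤ b := by exact_mod_cast hkb
      push_cast
      linarith
    · rw [Finset.mem_filter, Finset.mem_product, Finset.mem_Icc, Finset.mem_Icc] at hp
      obtain ⟨⟨⟨h1, h2⟩, h3, h4⟩, -⟩ := hp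
      push_cast at h1 h3
      rw [hk p.1 ⟨by omega, h2⟩ p.2 ⟨by omega, h4⟩, abs_zero]
  · have hka : kappaPlus c ξ₁ ξ₂ < toE (a + 1) := by
      refine lt_of_le_of_lt (not_lt.1 fun hlt => hmid ⟨a, ha', hlt⟩) (toE_lt_toE.2 (by omega))
    obtain ⟨_, ⟨m, ⟨hm1, hm2⟩, rfl⟩, hma⟩ := sInf_lt_iff.1 hka
    rw [toE_lt_toE] at hma
    -- `q` is the index `κ₊`: the least index beyond `κ₋` from which `c` lies in `ξ₂ ℝ`.
    obtain ⟨q, ⟨hq1, hq2⟩, hqmin⟩ := Int.exists_least_of_bdd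
      (P := fun m => kappaMinus c ξ₁ < toE m ∧ ∀ l ≥ m, (conj ξ₂ * c l).im = 0)
      ⟨b - M + 1, fun z hz => hb' z hz.2⟩ ⟨m, hm1, hm2⟩
    have hqm := hqmin m ⟨hm1, hm2⟩
    have hqb := hb' q hq2
    have hleft : ∀ l ≤ q - 1, (conj ξ₁ * c l).im = 0 := by
      rw [← toE_le_kappaMinus_iff]
      by_contra hcon
      refine hmid ⟨q - 1, not_le.1 hcon, (toE_lt_toE.2 (show q - 1 < q by omega)).trans_le ?_⟩
      refine le_sInf ?_
      rintro _ ⟨r, hr, rfl⟩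
      exact toE_le_toE.2 (hqmin r hr)
    have hq0 : (conj ξ₁ * c q).im ≠ 0 := by
      intro h0
      refine hq1.not_ge (toE_le_kappaMinus_iff.2 fun l hl => ?_)
      rcases hl.lt_or_eq with hl | rfl
      · exact hleft l (by omega)
      · exact h0
    obtain ⟨p, hp1, hp2, hp0⟩ : ∃ p, b - M ≤ p ∧ p ≤ q - 1 ∧ c p ≠ 0 := by
      by_contra! hcon
      refine hb (collin_of_forall_im hξ₂ fun l hl => ?_)
      rcases lt_or_ge l q with hlq | hlq
      · rw [hcon l hl.1 (by omega), mul_zero, Complex.zero_im]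
      · exact hq2 l hlq
    exact hq0 (im_conj_mul_eq_zero hξ₁ (hleft p hp2) hp0
      (hk p ⟨by omega, by omega⟩ q ⟨by omega, by omega⟩))

end ConjPhase

/-! ### Splines from phaseless Hermite samples -/

open ConjPhase in
theorem mainTheorem2 (N : ℕ) (hN : 3 ≤ N)
    (Γ Γ' : Finset ℝ)
    (hΓ : ∀ γ ∈ Γ, γ ∈ Set.Ioo (0 : ℝ) 1) (hΓcard : Γ.card = 2 * N - 1)
    (hΓ' : ∀ γ ∈ Γ', γ ∈ Set.Ioo (0 : ℝ) 1) (hΓ'card : Γ'.card = 2 * N - 5)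
    (f : ℝ → ℂ) (c : ℤ → ℂ) (hf : f = ConjPhase.splineSum N c)
    (hi : ConjPhase.CondI N c)
    (hii : ∃ ξ₁ ξ₂ : ℂ, ‖ξ₁‖ = 1 ∧ ‖ξ₂‖ = 1 ∧ ConjPhase.CondII N c ξ₁ ξ₂)
    (g : ℝ → ℂ) (hg : g ∈ ConjPhase.splineSpace N)
    (hval : ∀ γ ∈ Γ, ∀ j : ℤ, ‖g (γ + j)‖ = ‖f (γ + j)‖)
    (hder : ∀ γ' ∈ Γ', ∀ j : ℤ, ‖deriv g (γ' + j)‖ = ‖deriv f (γ' + j)‖) :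
    ∃ z : ℂ, ‖z‖ = 1 ∧
      ((∀ x, g x = z * f x) ∨ (∀ x, g x = z * (starRingEnd ℂ) (f x))) := by
  obtain ⟨n, rfl⟩ : ∃ n, N = n + 2 + 1 := ⟨N - 3, by omega⟩
  obtain ⟨d, rfl⟩ := hg
  obtain ⟨ξ₁, ξ₂, hξ₁, hξ₂, hii⟩ := hii
  subst hf
  have hloc : ∀ j : ℤ, ∃ z : ℂ, ‖z‖ = 1 ∧
      ((∀ k ∈ Set.Icc (j - (n + 2 : ℕ)) j, d k = z * c k) ∨
        ∀ k ∈ Set.Icc (j - (n + 2 : ℕ)) j, d k = z * (starRingEnd ℂ) (c k)) := by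
    intro j
    have hwin {a : ℤ → ℂ} (h : ∀ l ∈ Finset.range (n + 2 + 1), d (j - l) = a (j - l)) :
        ∀ k ∈ Set.Icc (j - (n + 2 : ℕ)) j, d k = a k := by
      intro k hk
      have := h (j - k).toNat (Finset.mem_range.2 (by have := hk.1; have := hk.2; omega))
      rwa [Int.toNat_of_nonneg (by have := hk.2; omega), sub_sub_cancel] at this
    obtain ⟨z, hz, h | h⟩ := exists_unimodular_or_conj_of_norm_eval_eq
      (natDegree_pieceComb_le (n + 2) fun l => c (j - l))
      (natDegree_pieceComb_le (n + 2) fun l => d (j - l))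
      (S := Γ) (T := Γ') (by omega) (by omega)
      (fun x hx => by
        rw [← splineSum_add_int _ _ _ (Set.Ioo_subset_Ico_self (hΓ x hx)),
          ← splineSum_add_int _ _ _ (Set.Ioo_subset_Ico_self (hΓ x hx)), hval x hx])
      (fun x hx => by
        rw [← deriv_splineSum_add_int _ _ _ (hΓ' x hx),
          ← deriv_splineSum_add_int _ _ _ (hΓ' x hx), hder x hx])
    · rw [C_mul_pieceComb] at h
      exact ⟨z, hz, Or.inl (hwin (a := fun k => z * c k) (pieceComb_injective h))⟩
    · rw [conjPoly, map_conj_pieceComb, C_mul_pieceComb] at h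
      exact ⟨z, hz, Or.inr (hwin (a := fun k => z * (starRingEnd ℂ) (c k))
        (pieceComb_injective h))⟩
  obtain ⟨z, hz, h | h⟩ := exists_global_phase_or_conj hloc (eq_zero_of_condI hi)
    (not_collin_of_condII hξ₁ hξ₂ hii)
  · refine ⟨z, hz, Or.inl fun x => ?_⟩
    simp only [splineSum, ← tsum_mul_left, h, mul_assoc]
  · refine ⟨z, hz, Or.inr fun x => ?_⟩
    simp only [splineSum, Complex.conj_tsum, ← tsum_mul_left, h, map_mul, Complex.conj_ofReal,
      mul_assoc]
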